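/- **Theorem 3.2.** Let $0<p<q\le\infty$, $0<r\le 1$, and put $\alpha=1/p-1/q$ (with $1/\infty=0$). There are constants $c_1,c_2>0$, depending only on $p$, $q$ and $r$, such that the following holds. Let $X,Y$ be $r$-normed quasi-Banach spaces over the same field $\mathbb{R}$ or $\mathbb{C}$, that is, complete quasi-normed spaces whose quasi-norms satisfy $\|z_1+z_2\|^r\le\|z_1\|^r+\|z_2\|^r$, and let $T_0:X\to Y$ be a bounded linear operator. Let $m,n\in\mathbb{N}$ with $2\le n\le m\le 2^n$, and let $T(m):l_p^m(X)\to l_q^m(Y)$ be the operator $T(m)(x_1,\dots,x_m)=(T_0x_1,\dots,T_0x_m)$. Then $$c_1\,A(n,m,T_0)\le e_n(T(m))\le c_2\,A(n,m,T_0),$$ where $$A(n,m,T_0)=\max\left(\|T_0\|\left(\frac{\log_2(m/n)+1}{n}\right)^{\alpha},\ \max_{k\in\{1,\dots,n\}}\left(\frac kn\right)^{\alpha}e_k(T_0)\right).$$ Here $l_p^m(X)$ is $X^m$ with the quasi-norm $\left(\sum_{i=1}^m\|x_i\|^p\right)^{1/p}$ if $p<\infty$ and $\max_{1\le i\le m}\|x_i\|$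 if $p=\infty$ (similarly $l_q^m(Y)$); $\|T\|=\sup_{\|x\|\le1}\|Tx\|$; and, for $n\ge 1$, the dyadic outer entropy number $e_n(T)$ is the infimum of those $\varepsilon>0$ such that the image under $T$ of the closed unit ball can be covered by $2^{n-1}$ balls of radius $\varepsilon$ in the target space. -/

import Mathlib

open scoped ENNReal

noncomputable section

namespace QuasiEntropy

/-- `N` is a quasi-norm on the `𝕜`-vector space `E`. -/
structure IsQuasiNorm (𝕜 : Type*) [RCLike 𝕜] {E : Type*} [AddCommGroup E] [Module 𝕜 E]
    (N : E → ℝ) : Prop where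
  nonneg : ∀ x, 0 ≤ N x
  eq_zero_iff : ∀ x, N x = 0 ↔ x = 0
  smul : ∀ (a : 𝕜) (x : E), N (a • x) = ‖a‖ * N x
  add_le : ∃ K : ℝ, ∀ x y, N (x + y) ≤ K * (N x + N y)

/-- `(E, N)` is a quasi-Banach space: `N` is a quasi-norm and every Cauchy sequence converges. -/
structure IsQuasiBanach (𝕜 : Type*) [RCLike 𝕜] {E : Type*} [AddCommGroup E] [Module 𝕜 E]
    (N : E → ℝ) : Prop extends IsQuasiNorm 𝕜 N where
  complete : ∀ u : ℕ → E,
    (∀ ε > 0, ∃ k : ℕ, ∀ i ≥ k, ∀ j ≥ k, N (u i - u j) < ε) →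
    ∃ x : E, Filter.Tendsto (fun i => N (u i - x)) Filter.atTop (nhds 0)

/-- `(E, N)` is an `r`-normed quasi-Banach space (an `r`-Banach space). -/
structure IsRBanach (𝕜 : Type*) [RCLike 𝕜] (r : ℝ) {E : Type*} [AddCommGroup E] [Module 𝕜 E]
    (N : E → ℝ) : Prop extends IsQuasiBanach 𝕜 N where
  add_rpow_le : ∀ x y, N (x + y) ^ r ≤ N x ^ r + N y ^ r

/-- The closed ball with centre `c` and radius `ε` for the quasi-norm `N`. -/
def qball {E : Type*} [AddCommGroup E] (N : E → ℝ) (c : E) (ε : ℝ) : Set E :=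
  {x | N (x - c) ≤ ε}

/-- The linear map `T` is bounded with respect to the quasi-norms `NX` and `NY`. -/
def IsBoundedOp {𝕜 X Y : Type*} [RCLike 𝕜] [AddCommGroup X] [Module 𝕜 X]
    [AddCommGroup Y] [Module 𝕜 Y] (NX : X → ℝ) (NY : Y → ℝ) (T : X →ₗ[𝕜] Y) : Prop :=
  ∃ C : ℝ, ∀ x, NY (T x) ≤ C * NX x

/-- The operator quasi-norm `‖T‖`, the supremum of `‖T x‖` over the closed unit ball. -/
def opNorm {𝕜 X Y : Type*} [RCLike 𝕜] [AddCommGroup X] [Module 𝕜 X]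
    [AddCommGroup Y] [Module 𝕜 Y] (NX : X → ℝ) (NY : Y → ℝ) (T : X →ₗ[𝕜] Y) : ℝ :=
  sSup ((fun x => NY (T x)) '' qball NX 0 1)

/-- The `n`-th dyadic outer entropy number (`n ≥ 1`) of a set `M`: the infimum of those `ε > 0`
such that `M` can be covered by `2 ^ (n - 1)` balls of radius `ε`. -/
def setEntropy {Y : Type*} [AddCommGroup Y] (NY : Y → ℝ) (n : ℕ) (M : Set Y) : ℝ :=
  sInf {ε : ℝ | 0 < ε ∧ ∃ c : Fin (2 ^ (n - 1)) → Y, M ⊆ ⋃ i, qball NY (c i) ε}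

/-- The `n`-th dyadic outer entropy number `e_n(T) = e_n(T(B_X))` of an operator (`n ≥ 1`). -/
def entropy {𝕜 X Y : Type*} [RCLike 𝕜] [AddCommGroup X] [Module 𝕜 X]
    [AddCommGroup Y] [Module 𝕜 Y] (NX : X → ℝ) (NY : Y → ℝ) (n : ℕ) (T : X →ₗ[𝕜] Y) : ℝ :=
  setEntropy NY n (T '' qball NX 0 1)

open Classical in
/-- The quasi-norm of `l_p^m(X)` on `X^m`, where `N` is the quasi-norm of `X`. -/
def lpNorm {X : Type*} (p : ℝ≥0∞) (m : ℕ) (N : X → ℝ) (x : Fin m → X) : ℝ :=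
  if p = ∞ then ⨆ i, N (x i) else (∑ i, N (x i) ^ p.toReal) ^ (1 / p.toReal)

/-- The coordinatewise operator `T(m) : X^m → Y^m`, `(x_1, …, x_m) ↦ (T₀ x_1, …, T₀ x_m)`. -/
def diagOp {𝕜 X Y : Type*} [RCLike 𝕜] [AddCommGroup X] [Module 𝕜 X]
    [AddCommGroup Y] [Module 𝕜 Y] (m : ℕ) (T₀ : X →ₗ[𝕜] Y) : (Fin m → X) →ₗ[𝕜] (Fin m → Y) :=
  T₀.compLeft (Fin m)

/-- The exponent `α = 1/p - 1/q`, with `1/∞ = 0`. -/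
def expo (p q : ℝ≥0∞) : ℝ := (1 / p).toReal - (1 / q).toReal

/-- The quantity
`A(n,m,T₀) = max (‖T₀‖ ((log₂(m/n) + 1)/n)^α, max_{1 ≤ k ≤ n} (k/n)^α e_k(T₀))`. -/
def boundA {𝕜 X Y : Type*} [RCLike 𝕜] [AddCommGroup X] [Module 𝕜 X]
    [AddCommGroup Y] [Module 𝕜 Y] (α : ℝ) (NX : X → ℝ) (NY : Y → ℝ) (n m : ℕ)
    (T₀ : X →ₗ[𝕜] Y) : ℝ :=
  max (opNorm NX NY T₀ * ((Real.logb 2 ((m : ℝ) / n) + 1) / n) ^ α)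
    (⨆ k : Set.Icc 1 n, (((k : ℕ) : ℝ) / n) ^ α * entropy NX NY (k : ℕ) T₀)

end QuasiEntropy

end

/-!
Put `u i = ‖x i‖ ^ p` for `x` in the unit ball of `l_p^m(X)`, so that `∑ u i ≤ 1`, and write
`L = log₂ (m / n) + 1` and `A = boundA α NX NY n m T₀`.

Upper bound (`entropy_diagOp_le`). With `s = n / (64 L)`, at most `s` coordinates satisfy
`u i > 1 / s`. The others are approximated by `0`; since `‖x i‖ = u i ^ (1 / q) * u i ^ α`, the
error is at most a multiple of `‖T₀‖ (L / n) ^ α * u i ^ (1 / q)`. A coordinate with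
`u i > 1 / s` receives `k = ⌊n u i / 64⌋ ≥ 1` bits, that is, it is approximated by one of
`2 ^ (k - 1)` centres of a rescaled optimal cover of the image of the unit ball, with error at most
a multiple of `(k / n) ^ (1 / p) * e_k(T₀)`, which is again at most a multiple of
`A * u i ^ (1 / q)`. So the whole error is at most a multiple of `A` in `l_q^m(Y)`. The number of
centres is estimated by a generating function (`sum_two_pow_le`, `count_le`).

Lower bound (`le_entropy_diagOp`). Place `4 ^ j` separated vectors as the letters of a
Gilbert–Varshamov code of length about `n / (j - 1)`. The `2 ^ n` code words, normalised in
`l_p^m(X)`, have separated images, and no ball of small radius contains two of them. Three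
alphabets give the terms of `A`: a separated set in the image of the unit ball gives `e_k(T₀)`, the
unit vectors `(0, …, x, …, 0)` of length about `m / n` give `‖T₀‖ (L / n) ^ α`, and multiples of
one vector settle the cases where `k` or `L` is bounded.
-/

namespace QuasiEntropy

/-! ### The quasi-norm of `l_p^m(X)` -/

section Sequence

variable {X : Type*} {N : X → ℝ} {m : ℕ} {q : ℝ≥0∞}

lemma lpNorm_le_iff (hN : ∀ x, 0 ≤ N x) (hq : 0 < q) (hq' : q ≠ ∞) (x : Fin m → X) {R : ℝ}
    (hR : 0 ≤ R) : lpNorm q m N x ≤ R ↔ ∑ i, N (x i) ^ q.toReal ≤ R ^ q.toReal := by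
  rw [lpNorm, if_neg hq', one_div]
  exact Real.rpow_inv_le_iff_of_pos (Finset.sum_nonneg fun i _ => Real.rpow_nonneg (hN _) _) hR
    (ENNReal.toReal_pos hq.ne' hq')

lemma lpNorm_top_le_iff (x : Fin m → X) {R : ℝ} (hR : 0 ≤ R) :
    lpNorm ∞ m N x ≤ R ↔ ∀ i, N (x i) ≤ R := by
  rw [lpNorm, if_pos rfl]
  exact ⟨fun h i => (le_ciSup (Set.finite_range _).bddAbove i).trans h,
    fun h => Real.iSup_le h hR⟩

lemma toReal_one_div (hq : 0 < q) (hq' : q ≠ ∞) : (1 / q).toReal * q.toReal = 1 := by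
  have := ENNReal.toReal_pos hq.ne' hq'
  simp only [one_div, ENNReal.toReal_inv]
  field_simp

lemma le_one_of_lpNorm_le_one (hN : ∀ x, 0 ≤ N x) (hq : 0 < q) {x : Fin m → X}
    (hx : lpNorm q m N x ≤ 1) (i : Fin m) : N (x i) ≤ 1 := by
  by_cases hq' : q = ∞
  · subst hq'
    exact (lpNorm_top_le_iff x zero_le_one).1 hx i
  · rw [lpNorm_le_iff hN hq hq' x zero_le_one, Real.one_rpow] at hx
    have h := (Finset.single_le_sum (f := fun i => N (x i) ^ q.toReal)
      (fun i _ => Real.rpow_nonneg (hN _) _) (Finset.mem_univ i)).trans hx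
    exact le_of_not_gt fun h1 =>
      (Real.one_lt_rpow h1 (ENNReal.toReal_pos hq.ne' hq')).not_ge h

/-- The exponent `(1 / q).toReal` is `0` for `q = ∞`, so that the hypothesis is then just a
bound by `D`. -/
lemma lpNorm_le_of_le_mul_rpow (hN : ∀ x, 0 ≤ N x) (hq : 0 < q) {x : Fin m → X} {D : ℝ}
    (hD : 0 ≤ D) {u : Fin m → ℝ} (hu : ∀ i, 0 ≤ u i) (hu1 : ∑ i, u i ≤ 1)
    (h : ∀ i, N (x i) ≤ D * u i ^ (1 / q).toReal) : lpNorm q m N x ≤ D := by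
  by_cases hq' : q = ∞
  · subst hq'
    rw [lpNorm_top_le_iff x hD]
    simpa using h
  · rw [lpNorm_le_iff hN hq hq' x hD]
    have hq0 := ENNReal.toReal_pos hq.ne' hq'
    calc ∑ i, N (x i) ^ q.toReal ≤ ∑ i, D ^ q.toReal * u i := by
          refine Finset.sum_le_sum fun i _ => ?_
          refine (Real.rpow_le_rpow (hN _) (h i) hq0.le).trans_eq ?_
          rw [Real.mul_rpow hD (Real.rpow_nonneg (hu i) _), ← Real.rpow_mul (hu i),
            toReal_one_div hq hq', Real.rpow_one]
      _ ≤ D ^ q.toReal := by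
          rw [← Finset.mul_sum]
          exact mul_le_of_le_one_right (Real.rpow_nonneg hD _) hu1

lemma lpNorm_le_of_le (hN : ∀ x, 0 ≤ N x) (hq : 0 < q) {x : Fin m → X} {D : ℝ} (hD : 0 ≤ D)
    (h : ∀ i, N (x i) ≤ D) : lpNorm q m N x ≤ D * (m : ℝ) ^ (1 / q).toReal := by
  rcases Nat.eq_zero_or_pos m with rfl | hm
  · by_cases hq' : q = ∞
    · subst hq'
      rw [lpNorm_top_le_iff x (by positivity)]
      simp
    · rw [lpNorm_le_iff hN hq hq' x (by positivity)]
      simp only [Finset.univ_eq_empty, Finset.sum_empty]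
      positivity
  · have hm' : (0 : ℝ) < m := by exact_mod_cast hm
    refine lpNorm_le_of_le_mul_rpow hN hq (by positivity) (u := fun _ => (m : ℝ)⁻¹)
      (fun _ => by positivity) (by simp [hm'.ne']) fun i => ?_
    rw [mul_assoc, ← Real.mul_rpow hm'.le (by positivity), mul_inv_cancel₀ hm'.ne',
      Real.one_rpow, mul_one]
    exact h i

end Sequence

section Triangle

variable {𝕜 X : Type*} [RCLike 𝕜] [AddCommGroup X] [Module 𝕜 X] {N : X → ℝ}

lemma IsQuasiNorm.neg (h : IsQuasiNorm 𝕜 N) (x : X) : N (-x) = N x := by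
  have := h.smul (-1) x
  simpa using this

lemma IsQuasiNorm.zero (h : IsQuasiNorm 𝕜 N) : N 0 = 0 := (h.eq_zero_iff 0).2 rfl

lemma IsRBanach.sub_le {r : ℝ} (hr : 0 < r) (h : IsRBanach 𝕜 r N) {x y : X} {a : ℝ}
    (hx : N x ≤ a) (hy : N y ≤ a) : N (x - y) ≤ 2 ^ (1 / r) * a := by
  have ha : 0 ≤ a := (h.nonneg x).trans hx
  have h1 := h.add_rpow_le x (-y)
  rw [h.toIsQuasiNorm.neg, ← sub_eq_add_neg] at h1
  have h2 : N (x - y) ^ r ≤ 2 * a ^ r := by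
    have := Real.rpow_le_rpow (h.nonneg x) hx hr.le
    have := Real.rpow_le_rpow (h.nonneg y) hy hr.le
    linarith
  rw [← Real.rpow_le_rpow_iff (h.nonneg _) (by positivity) hr,
    Real.mul_rpow (by positivity) ha, ← Real.rpow_mul (by norm_num), one_div,
    inv_mul_cancel₀ hr.ne', Real.rpow_one]
  exact h2

/-- Two points of one ball of radius `ε` in `l_q^m(X)` are at distance at most a multiple of `ε`
that depends only on `q` and `r`. -/
lemma lpNorm_sub_le {r : ℝ} (hr : 0 < r) (h : IsRBanach 𝕜 r N) {q : ℝ≥0∞} (hq : 0 < q) {m : ℕ}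
    {x y c : Fin m → X} {ε : ℝ} (hε : 0 ≤ ε) (hx : lpNorm q m N (x - c) ≤ ε)
    (hy : lpNorm q m N (y - c) ≤ ε) :
    lpNorm q m N (x - y) ≤ 2 ^ (1 / r + (1 / q).toReal) * ε := by
  have key : ∀ i {a : ℝ}, N ((x - c) i) ≤ a → N ((y - c) i) ≤ a →
      N ((x - y) i) ≤ 2 ^ (1 / r) * a := by
    intro i a h1 h2
    have := h.sub_le hr h1 h2
    simpa using this
  by_cases hq' : q = ∞
  · subst hq'
    rw [lpNorm_top_le_iff _ hε] at hx hy
    rw [lpNorm_top_le_iff _ (by positivity)]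
    intro i
    simpa using key i (hx i) (hy i)
  · have hq0 := ENNReal.toReal_pos hq.ne' hq'
    rw [lpNorm_le_iff h.nonneg hq hq' _ hε] at hx hy
    rw [lpNorm_le_iff h.nonneg hq hq' _ (by positivity)]
    calc ∑ i, N ((x - y) i) ^ q.toReal
        ≤ ∑ i, (2 ^ (1 / r)) ^ q.toReal *
            (N ((x - c) i) ^ q.toReal + N ((y - c) i) ^ q.toReal) := by
          refine Finset.sum_le_sum fun i _ => ?_
          have h1 := Real.rpow_nonneg (h.nonneg ((x - c) i)) q.toReal
          have h2 := Real.rpow_nonneg (h.nonneg ((y - c) i)) q.toReal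
          have h3 := Real.rpow_le_rpow (h.nonneg _)
            (key i (le_max_left (N ((x - c) i)) (N ((y - c) i))) (le_max_right _ _)) hq0.le
          have h4 : 0 ≤ max (N ((x - c) i)) (N ((y - c) i)) := le_max_of_le_left (h.nonneg _)
          rw [Real.mul_rpow (by positivity) h4] at h3
          refine h3.trans (mul_le_mul_of_nonneg_left ?_ (by positivity))
          rcases max_choice (N ((x - c) i)) (N ((y - c) i)) with h5 | h5 <;> rw [h5] <;> linarith
      _ ≤ (2 ^ (1 / r)) ^ q.toReal * (2 * ε ^ q.toReal) := by
          rw [← Finset.mul_sum, Finset.sum_add_distrib]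
          exact mul_le_mul_of_nonneg_left (by linarith) (by positivity)
      _ = (2 ^ (1 / r + (1 / q).toReal) * ε) ^ q.toReal := by
          rw [Real.mul_rpow (by positivity) hε, Real.rpow_add (by norm_num),
            Real.mul_rpow (by positivity) (by positivity),
            ← Real.rpow_mul (by norm_num) (1 / q).toReal, toReal_one_div hq hq', Real.rpow_one]
          ring

end Triangle

/-! ### Operator norm and entropy numbers -/

section Operators

variable {𝕜 X Y : Type*} [RCLike 𝕜] [AddCommGroup X] [Module 𝕜 X]
    [AddCommGroup Y] [Module 𝕜 Y] {NX : X → ℝ} {NY : Y → ℝ}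

lemma le_opNorm_of_le_one (hX : ∀ x, 0 ≤ NX x) {T : X →ₗ[𝕜] Y} (hT : IsBoundedOp NX NY T) {x : X}
    (hx : NX x ≤ 1) : NY (T x) ≤ opNorm NX NY T := by
  obtain ⟨C, hC⟩ := hT
  refine le_csSup ⟨|C|, ?_⟩ ⟨x, by simpa [qball] using hx, rfl⟩
  rintro _ ⟨y, hy, rfl⟩
  have hy1 : NX y ≤ 1 := by simpa [qball] using hy
  calc NY (T y) ≤ C * NX y := hC y
    _ ≤ |C| * NX y := mul_le_mul_of_nonneg_right (le_abs_self C) (hX y)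
    _ ≤ |C| := mul_le_of_le_one_right (abs_nonneg C) hy1

lemma opNorm_nonneg (hX : IsQuasiNorm 𝕜 NX) (hY : ∀ y, 0 ≤ NY y) {T : X →ₗ[𝕜] Y}
    (hT : IsBoundedOp NX NY T) : 0 ≤ opNorm NX NY T :=
  (hY (T 0)).trans (le_opNorm_of_le_one hX.nonneg hT (by simp [hX.zero]))

lemma norm_ofReal_smul (hX : IsQuasiNorm 𝕜 NX) {a : ℝ} (ha : 0 ≤ a) (x : X) :
    NX ((a : 𝕜) • x) = a * NX x := by
  rw [hX.smul, RCLike.norm_ofReal, abs_of_nonneg ha]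

lemma le_opNorm (hX : IsQuasiNorm 𝕜 NX) (hY : IsQuasiNorm 𝕜 NY) {T : X →ₗ[𝕜] Y}
    (hT : IsBoundedOp NX NY T) (x : X) : NY (T x) ≤ opNorm NX NY T * NX x := by
  rcases (hX.nonneg x).eq_or_lt with h | h
  · have hx : x = 0 := (hX.eq_zero_iff x).1 h.symm
    simp [hx, hX.zero, hY.zero]
  · have h1 := le_opNorm_of_le_one (𝕜 := 𝕜) hX.nonneg hT (x := (((NX x)⁻¹ : ℝ) : 𝕜) • x)
      (by rw [norm_ofReal_smul hX (by positivity), inv_mul_cancel₀ h.ne'])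
    rw [map_smul, norm_ofReal_smul hY (by positivity)] at h1
    rwa [← div_le_iff₀ h, div_eq_inv_mul]

lemma entropy_nonneg (n : ℕ) (T : X →ₗ[𝕜] Y) : 0 ≤ entropy NX NY n T :=
  Real.sInf_nonneg fun _ h => h.1.le

/-- A cover by a finite set of at most `2 ^ (n - 1)` centres bounds the entropy number. -/
lemma entropy_le_of_finset {n : ℕ} {T : X →ₗ[𝕜] Y} {ε : ℝ} (hε : 0 < ε) (C : Finset Y)
    (hC : C.card ≤ 2 ^ (n - 1)) (h : ∀ x, NX x ≤ 1 → ∃ c ∈ C, NY (T x - c) ≤ ε) :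
    entropy NX NY n T ≤ ε := by
  refine csInf_le ⟨0, fun _ h => h.1.le⟩ ⟨hε, ?_⟩
  refine ⟨fun i => if hi : (i : ℕ) < C.card then (C.equivFin.symm ⟨i, hi⟩ : Y) else 0, ?_⟩
  rintro _ ⟨x, hx, rfl⟩
  obtain ⟨c, hc, hcx⟩ := h x (by simpa [qball] using hx)
  have hlt : ((C.equivFin ⟨c, hc⟩ : Fin C.card) : ℕ) < C.card := (C.equivFin ⟨c, hc⟩).2
  refine Set.mem_iUnion.2 ⟨⟨C.equivFin ⟨c, hc⟩, hlt.trans_le hC⟩, ?_⟩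
  simpa [qball, hlt] using hcx

lemma entropy_cover_nonempty (n : ℕ) {T : X →ₗ[𝕜] Y} (hT : ∃ C, ∀ x, NX x ≤ 1 → NY (T x) ≤ C) :
    {ε : ℝ | 0 < ε ∧ ∃ c : Fin (2 ^ (n - 1)) → Y,
      T '' qball NX 0 1 ⊆ ⋃ i, qball NY (c i) ε}.Nonempty := by
  obtain ⟨C, hC⟩ := hT
  refine ⟨|C| + 1, by positivity, 0, ?_⟩
  rintro _ ⟨x, hx, rfl⟩
  refine Set.mem_iUnion.2 ⟨⟨0, by positivity⟩, ?_⟩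
  have h1 : NX x ≤ 1 := by simpa [qball] using hx
  have h2 := hC x h1
  have h3 := le_abs_self C
  simp only [qball, Pi.zero_apply, sub_zero, Set.mem_ofPred_eq]
  linarith

lemma exists_finset_of_entropy_lt {n : ℕ} {T : X →ₗ[𝕜] Y} (hT : ∃ C, ∀ x, NX x ≤ 1 → NY (T x) ≤ C)
    {ε : ℝ} (h : entropy NX NY n T < ε) :
    ∃ C : Finset Y, C.card ≤ 2 ^ (n - 1) ∧ ∀ x, NX x ≤ 1 → ∃ c ∈ C, NY (T x - c) ≤ ε := by
  classical
  obtain ⟨ε', ⟨-, c, hc⟩, hlt⟩ := exists_lt_of_csInf_lt (entropy_cover_nonempty n hT) h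
  refine ⟨Finset.univ.image c, Finset.card_image_le.trans (by simp), fun x hx => ?_⟩
  obtain ⟨i, hi⟩ := Set.mem_iUnion.1 (hc ⟨x, by simpa [qball] using hx, rfl⟩)
  exact ⟨c i, Finset.mem_image_of_mem _ (Finset.mem_univ i), le_trans hi hlt.le⟩

lemma exists_bound (hX : ∀ x, 0 ≤ NX x) {T : X →ₗ[𝕜] Y} (hT : IsBoundedOp NX NY T) :
    ∃ C, ∀ x, NX x ≤ 1 → NY (T x) ≤ C :=
  ⟨_, fun _ hx => le_opNorm_of_le_one hX hT hx⟩

lemma entropy_le_opNorm (hX : IsQuasiNorm 𝕜 NX) (hY : ∀ y, 0 ≤ NY y) (n : ℕ) {T : X →ₗ[𝕜] Y}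
    (hT : IsBoundedOp NX NY T) : entropy NX NY n T ≤ opNorm NX NY T := by
  refine le_of_forall_pos_le_add fun ε hε => ?_
  refine entropy_le_of_finset (by linarith [opNorm_nonneg hX hY hT]) {0}
    (by simpa using Nat.one_le_two_pow) fun x hx => ⟨0, by simp, ?_⟩
  rw [sub_zero]
  linarith [le_opNorm_of_le_one hX.nonneg hT hx]

/-- Pigeonhole: more than `2 ^ (n - 1)` separated points in the image of the unit ball bound the
`n`-th entropy number from below. -/
lemma le_entropy_of_separated {n : ℕ} {T : X →ₗ[𝕜] Y} (hT : ∃ C, ∀ x, NX x ≤ 1 → NY (T x) ≤ C)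
    {K δ : ℝ} (hK : 0 < K)
    (htri : ∀ {x y c : Y} {ε : ℝ}, 0 ≤ ε → NY (x - c) ≤ ε → NY (y - c) ≤ ε → NY (x - y) ≤ K * ε)
    {ι : Type*} [Fintype ι] (hι : 2 ^ (n - 1) < Fintype.card ι) (f : ι → X)
    (hf : ∀ i, NX (f i) ≤ 1) (hsep : ∀ i j, i ≠ j → δ ≤ NY (T (f i) - T (f j))) :
    δ ≤ K * entropy NX NY n T := by
  rw [← div_le_iff₀' hK]
  refine le_csInf (entropy_cover_nonempty n hT) ?_
  rintro ε ⟨hε, c, hc⟩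
  have h1 : ∀ i, ∃ j, T (f i) ∈ qball NY (c j) ε := fun i =>
    Set.mem_iUnion.1 (hc ⟨f i, by simpa [qball] using hf i, rfl⟩)
  choose g hg using h1
  obtain ⟨i, j, hij, hgij⟩ := Fintype.exists_ne_map_eq_of_card_lt g (by simpa using hι)
  rw [div_le_iff₀' hK]
  refine (hsep i j hij).trans (htri hε.le (hg i) ?_)
  rw [hgij]
  exact hg j

lemma diagOp_apply (m : ℕ) (T : X →ₗ[𝕜] Y) (x : Fin m → X) (i : Fin m) :
    diagOp m T x i = T (x i) := rfl

lemma exists_bound_diagOp (hX : IsQuasiNorm 𝕜 NX) (hY : IsQuasiNorm 𝕜 NY) {T : X →ₗ[𝕜] Y}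
    (hT : IsBoundedOp NX NY T) {p q : ℝ≥0∞} (hp : 0 < p) (hq : 0 < q) (m : ℕ) :
    ∃ C, ∀ x, lpNorm p m NX x ≤ 1 → lpNorm q m NY (diagOp m T x) ≤ C := by
  refine ⟨opNorm NX NY T * (m : ℝ) ^ (1 / q).toReal, fun x hx => ?_⟩
  exact lpNorm_le_of_le hY.nonneg hq (opNorm_nonneg hX hY.nonneg hT)
    fun i => le_opNorm_of_le_one hX.nonneg hT (le_one_of_lpNorm_le_one hX.nonneg hp hx i)

end Operators

/-! ### The upper bound -/

/-- The total number of centres used for the upper bound: `κ i` is the number of bits spent on the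
`i`-th coordinate. The sum is compared with the product of the generating functions
`1 + y ∑ 2 ^ (-k)` of the single coordinates. -/
lemma sum_two_pow_le {m : ℕ} (n : ℕ) {a s y : ℝ} (hy : 0 < y) (hy1 : y ≤ 1)
    (F : Finset (Fin m → ℕ)) (hF : ∀ κ ∈ F, ∀ i, κ i ≤ n) (ha : ∀ κ ∈ F, ∑ i, (κ i : ℝ) ≤ a)
    (hs : ∀ κ ∈ F, ((Finset.univ.filter fun i => κ i ≠ 0).card : ℝ) ≤ s) :
    ∑ κ ∈ F, (2 : ℝ) ^ ∑ i, κ i ≤ 4 ^ a * y ^ (-s) * Real.exp (y * m) := by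
  set w : ℕ → ℝ := fun k => (1 / 2) ^ k * if k = 0 then 1 else y with hw
  have hw0 : ∀ k, 0 ≤ w k := fun k => by simp only [hw]; positivity
  have hprod : ∀ κ : Fin m → ℕ, ∏ i, w (κ i) =
      (1 / 2) ^ (∑ i, κ i) * y ^ (Finset.univ.filter fun i => κ i ≠ 0).card := by
    intro κ
    simp only [hw, Finset.prod_mul_distrib, Finset.prod_pow_eq_pow_sum, Finset.prod_ite,
      Finset.prod_const, one_pow, one_mul, ne_eq]
  have hterm : ∀ κ ∈ F, (2 : ℝ) ^ ∑ i, κ i ≤ 4 ^ a * y ^ (-s) * ∏ i, w (κ i) := by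
    intro κ hκ
    rw [hprod]
    have h1 : (4 : ℝ) ^ ∑ i, κ i ≤ 4 ^ a := by
      rw [← Real.rpow_natCast]
      exact Real.rpow_le_rpow_of_exponent_le (by norm_num) (by simpa using ha κ hκ)
    have h2 : 1 ≤ y ^ (-s) * y ^ (Finset.univ.filter fun i => κ i ≠ 0).card := by
      rw [← Real.rpow_natCast y, ← Real.rpow_add hy]
      exact Real.one_le_rpow_of_pos_of_le_one_of_nonpos hy hy1 (by linarith [hs κ hκ])
    calc (2 : ℝ) ^ ∑ i, κ i = 4 ^ (∑ i, κ i) * (1 / 2) ^ (∑ i, κ i) * 1 := by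
          rw [← mul_pow, mul_one]; norm_num
      _ ≤ 4 ^ a * (1 / 2) ^ (∑ i, κ i) *
          (y ^ (-s) * y ^ (Finset.univ.filter fun i => κ i ≠ 0).card) := by gcongr
      _ = _ := by ring
  have hsum : ∑ k ∈ Finset.range (n + 1), w k ≤ 1 + y := by
    have h1 : ∀ n : ℕ, ∑ k ∈ Finset.range n, w (k + 1) = (1 - (1 / 2) ^ n) * y := by
      intro n
      induction n with
      | zero => simp
      | succ n ih =>
        rw [Finset.sum_range_succ, ih]
        simp only [hw, Nat.add_eq_zero_iff, one_ne_zero, and_false, if_false]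
        ring
    rw [Finset.sum_range_succ', h1]
    have h2 : w 0 = 1 := by simp [hw]
    have h3 : 0 ≤ (1 / 2 : ℝ) ^ n * y := by positivity
    linarith
  calc ∑ κ ∈ F, (2 : ℝ) ^ ∑ i, κ i ≤ ∑ κ ∈ F, 4 ^ a * y ^ (-s) * ∏ i, w (κ i) :=
        Finset.sum_le_sum hterm
    _ ≤ ∑ κ ∈ Fintype.piFinset fun _ : Fin m => Finset.range (n + 1),
          4 ^ a * y ^ (-s) * ∏ i, w (κ i) := by
        refine Finset.sum_le_sum_of_subset_of_nonneg (fun κ hκ => ?_) fun κ _ _ => ?_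
        · simpa [Fintype.mem_piFinset, Nat.lt_succ_iff] using hF κ hκ
        · exact mul_nonneg (by positivity) (Finset.prod_nonneg fun i _ => hw0 _)
    _ = 4 ^ a * y ^ (-s) * (∑ k ∈ Finset.range (n + 1), w k) ^ m := by
        rw [← Finset.mul_sum, ← Finset.prod_univ_sum (fun _ : Fin m => Finset.range (n + 1))
          (fun _ k => w k)]
        simp
    _ ≤ 4 ^ a * y ^ (-s) * Real.exp (y * m) := by
        gcongr
        calc (∑ k ∈ Finset.range (n + 1), w k) ^ m ≤ Real.exp y ^ m := by
              refine pow_le_pow_left₀ (Finset.sum_nonneg fun k _ => hw0 k) (hsum.trans ?_) m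
              linarith [Real.add_one_le_exp y]
          _ = Real.exp (y * m) := by rw [← Real.exp_nat_mul, mul_comm]

/-- The quantity `log₂ (m / n) + 1`. -/
noncomputable def logRatio (n m : ℕ) : ℝ := Real.logb 2 ((m : ℝ) / n) + 1

lemma one_le_logRatio {n m : ℕ} (hn : 0 < n) (hnm : n ≤ m) : 1 ≤ logRatio n m := by
  have hn' : (0 : ℝ) < n := by exact_mod_cast hn
  have : (1 : ℝ) ≤ m / n := by
    rw [one_le_div hn']
    exact_mod_cast hnm
  have := Real.logb_nonneg (b := 2) (by norm_num) this
  unfold logRatio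
  linarith

lemma count_le {n m : ℕ} (hn : 2 ≤ n) (hnm : n ≤ m) {s : ℝ} (hs : s = n / (64 * logRatio n m)) :
    (4 : ℝ) ^ ((n : ℝ) / 64) * (s / m) ^ (-s) * Real.exp (s / m * m) ≤ 2 ^ (n - 1) := by
  have hL := one_le_logRatio (by omega) hnm
  have hlog : Real.log ((m : ℝ) / n) = (logRatio n m - 1) * Real.log 2 := by
    unfold logRatio Real.logb
    have := Real.log_pos (x := 2) (by norm_num)
    field_simp
    ring
  set l := logRatio n m with hl
  have hn2 : (2 : ℝ) ≤ n := by exact_mod_cast hn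
  have hm2 : (2 : ℝ) ≤ m := by exact_mod_cast hn.trans hnm
  have hn0 : (0 : ℝ) < n := by linarith
  have hm0 : (0 : ℝ) < m := by linarith
  have hl0 : 0 < l := by linarith
  have hs0 : 0 < s := by rw [hs]; positivity
  have hsl : s * l = n / 64 := by rw [hs]; field_simp
  have h2 := Real.log_two_gt_d9
  have h2' := Real.log_two_lt_d9
  have hsm : Real.log (s / m) = -((l - 1) * Real.log 2 + 6 * Real.log 2 + Real.log l) := by
    have : s / m = ((m / n : ℝ) * (2 ^ 6 * l))⁻¹ := by rw [hs]; field_simp; norm_num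
    rw [this, Real.log_inv, Real.log_mul (by positivity) (by positivity),
      Real.log_mul (by positivity) (by positivity), Real.log_pow, hlog]
    push_cast
    ring
  have h4 : Real.log 4 = 2 * Real.log 2 := by
    rw [show (4 : ℝ) = 2 ^ 2 by norm_num, Real.log_pow]; push_cast; ring
  have hll := Real.log_le_sub_one_of_pos hl0
  rw [← Real.log_le_log_iff (by positivity) (by positivity), Real.log_mul (by positivity)
    (by positivity), Real.log_mul (by positivity) (by positivity), Real.log_rpow (by norm_num),
    Real.log_rpow (by positivity), Real.log_exp, Real.log_pow, hsm, h4, Nat.cast_sub (by omega),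
    div_mul_cancel₀ _ hm0.ne', Nat.cast_one]
  have h5 : s * ((l - 1) * Real.log 2 + 6 * Real.log 2 + Real.log l + 1) ≤ s * (l * 8) := by
    refine mul_le_mul_of_nonneg_left ?_ hs0.le
    nlinarith
  nlinarith

section Upper

variable {𝕜 X Y : Type*} [RCLike 𝕜] [AddCommGroup X] [Module 𝕜 X]
    [AddCommGroup Y] [Module 𝕜 Y] {NX : X → ℝ} {NY : Y → ℝ}

/-- Rescaled covers of the image of the unit ball. -/
lemma exists_cover_scaled (hX : IsQuasiNorm 𝕜 NX) (hY : IsQuasiNorm 𝕜 NY) {T : X →ₗ[𝕜] Y}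
    (hT : IsBoundedOp NX NY T) {k : ℕ} {ε τ : ℝ} (hτ : 0 < τ) (h : entropy NX NY k T < ε) :
    ∃ C : Finset Y, C.card ≤ 2 ^ k ∧ ∀ x, NX x ≤ τ → ∃ c ∈ C, NY (T x - c) ≤ τ * ε := by
  classical
  obtain ⟨C, hC, hcov⟩ := exists_finset_of_entropy_lt (exists_bound hX.nonneg hT) h
  refine ⟨C.image fun c => (τ : 𝕜) • c, Finset.card_image_le.trans
    (hC.trans (Nat.pow_le_pow_right (by norm_num) (by omega))), fun x hx => ?_⟩
  have hτ' : (τ : 𝕜) ≠ 0 := by exact_mod_cast hτ.ne'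
  obtain ⟨c, hc, hcx⟩ := hcov (((τ⁻¹ : ℝ) : 𝕜) • x) (by
    rw [norm_ofReal_smul hX (by positivity), inv_mul_le_iff₀ hτ, mul_one]
    exact hx)
  refine ⟨_, Finset.mem_image_of_mem _ hc, ?_⟩
  have : T x - (τ : 𝕜) • c = (τ : 𝕜) • (T (((τ⁻¹ : ℝ) : 𝕜) • x) - c) := by
    rw [smul_sub, map_smul, smul_smul, RCLike.ofReal_inv, mul_inv_cancel₀ hτ', one_smul]
  rw [this, norm_ofReal_smul hY hτ.le]
  exact mul_le_mul_of_nonneg_left hcx hτ.le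

/-- Coordinates with `‖x i‖ ^ p ≤ 1 / s` are approximated by `0`; on any other coordinate
`⌊n ‖x i‖ ^ p / 64⌋ ≥ 1` bits are spent. In both cases the error is at most a multiple of
`‖x i‖ ^ (p / q)`. -/
lemma entropy_diagOp_le (hX : IsQuasiNorm 𝕜 NX) (hY : IsQuasiNorm 𝕜 NY) {T : X →ₗ[𝕜] Y}
    (hT : IsBoundedOp NX NY T) {p q : ℝ≥0∞} (hp : 0 < p) (hpq : p < q) {n m : ℕ} (hn : 2 ≤ n)
    (hnm : n ≤ m) {A : ℝ} (hA : 0 < A)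
    (h1 : opNorm NX NY T * (logRatio n m / n) ^ expo p q ≤ A)
    (h2 : ∀ k : ℕ, 1 ≤ k → k ≤ n → ((k : ℝ) / n) ^ expo p q * entropy NX NY k T < A) :
    entropy (lpNorm p m NX) (lpNorm q m NY) n (diagOp m T) ≤ 128 ^ (1 / p).toReal * A := by
  classical
  have hq : 0 < q := hp.trans hpq
  have hp' : p ≠ ∞ := hpq.ne_top
  have hL := one_le_logRatio (by omega) hnm
  set l := logRatio n m with hl
  set b := (1 / q).toReal with hb
  set d := (1 / p).toReal with hd
  have hexpo : expo p q = d - b := rfl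
  have hb0 : 0 ≤ b := ENNReal.toReal_nonneg
  have hbd : b ≤ d := by
    refine ENNReal.toReal_mono (by simp [hp.ne']) ?_
    simpa using hpq.le
  have hn2 : (2 : ℝ) ≤ n := by exact_mod_cast hn
  have hnm' : (n : ℝ) ≤ m := by exact_mod_cast hnm
  have hn0 : (0 : ℝ) < n := by linarith
  have hm0 : (0 : ℝ) < m := by linarith
  set s : ℝ := n / (64 * l) with hs
  have hs0 : 0 < s := by positivity
  have hsn : s ≤ n := div_le_self hn0.le (by linarith)
  -- The centres for a coordinate on which `k` bits are spent.
  have hC : ∀ k : ℕ, ∃ C : Finset Y, C.card ≤ 2 ^ k ∧ (k = 0 → C = {0}) ∧ (1 ≤ k → k ≤ n →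
      ∀ x, NX x ≤ (128 * k / n) ^ d →
        ∃ c ∈ C, NY (T x - c) ≤ (128 * k / n) ^ d * (A * ((k : ℝ) / n) ^ (-(d - b)))) := by
    intro k
    by_cases hk : 1 ≤ k ∧ k ≤ n
    · have hk0 : (0 : ℝ) < k := by exact_mod_cast hk.1
      obtain ⟨C, hC, hcov⟩ := exists_cover_scaled hX hY hT (k := k)
        (ε := A * ((k : ℝ) / n) ^ (-(d - b))) (τ := (128 * k / n) ^ d) (by positivity) (by
          rw [Real.rpow_neg (by positivity), ← div_eq_mul_inv, lt_div_iff₀' (by positivity)]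
          exact h2 k hk.1 hk.2)
      exact ⟨C, hC, fun h => by omega, fun _ _ => hcov⟩
    · exact ⟨{0}, by simpa using Nat.one_le_two_pow, fun _ => rfl, fun h h' => absurd ⟨h, h'⟩ hk⟩
  choose C hCcard hC0 hCcov using hC
  set F : Finset (Fin m → ℕ) := (Fintype.piFinset fun _ => Finset.range (n + 1)).filter fun κ =>
    ∑ i, (κ i : ℝ) ≤ n / 64 ∧ ((Finset.univ.filter fun i => κ i ≠ 0).card : ℝ) ≤ s with hF
  refine entropy_le_of_finset (by positivity) (F.biUnion fun κ => Fintype.piFinset fun i => C (κ i))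
    ?_ ?_
  · have hcount : ((F.biUnion fun κ => Fintype.piFinset fun i => C (κ i)).card : ℝ) ≤
        2 ^ (n - 1) := by
      calc ((F.biUnion fun κ => Fintype.piFinset fun i => C (κ i)).card : ℝ)
          ≤ ∑ κ ∈ F, (2 : ℝ) ^ ∑ i, κ i := by
            have : (F.biUnion fun κ => Fintype.piFinset fun i => C (κ i)).card ≤
                ∑ κ ∈ F, 2 ^ ∑ i, κ i := by
              refine Finset.card_biUnion_le.trans (Finset.sum_le_sum fun κ _ => ?_)
              rw [Fintype.card_piFinset, ← Finset.prod_pow_eq_pow_sum]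
              exact Finset.prod_le_prod' fun i _ => hCcard _
            exact_mod_cast this
        _ ≤ 4 ^ ((n : ℝ) / 64) * (s / m) ^ (-s) * Real.exp (s / m * m) := by
            refine sum_two_pow_le n (by positivity) ((div_le_one hm0).2 (hsn.trans hnm')) F
              (fun κ hκ i => ?_) (fun κ hκ => ?_) (fun κ hκ => ?_)
            · have := Fintype.mem_piFinset.1 (Finset.mem_filter.1 hκ).1 i
              simpa [Nat.lt_succ_iff] using this
            · exact (Finset.mem_filter.1 hκ).2.1
            · exact (Finset.mem_filter.1 hκ).2.2
        _ ≤ 2 ^ (n - 1) := count_le hn hnm hs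
    exact_mod_cast hcount
  · intro x hx
    set u : Fin m → ℝ := fun i => NX (x i) ^ p.toReal with hu
    have hu0 : ∀ i, 0 ≤ u i := fun i => Real.rpow_nonneg (hX.nonneg _) _
    have husum : ∑ i, u i ≤ 1 := by
      rwa [lpNorm_le_iff hX.nonneg hp hp' x zero_le_one, Real.one_rpow] at hx
    have hu1 : ∀ i, u i ≤ 1 := fun i =>
      (Finset.single_le_sum (fun i _ => hu0 i) (Finset.mem_univ i)).trans husum
    have hux : ∀ i, NX (x i) = u i ^ d := fun i => by
      rw [hu, ← Real.rpow_mul (hX.nonneg _), mul_comm, toReal_one_div hp hp', Real.rpow_one]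
    set κ : Fin m → ℕ := fun i => if u i ≤ 1 / s then 0 else ⌊n * u i / 64⌋₊ with hκ
    have hκle : ∀ i, (κ i : ℝ) ≤ n * u i / 64 := fun i => by
      have h0 : 0 ≤ n * u i / 64 := by have := hu0 i; positivity
      simp only [hκ]
      split_ifs
      · simpa using h0
      · exact Nat.floor_le h0
    have hκn : ∀ i, κ i ≤ n := fun i => by
      have : (κ i : ℝ) ≤ n := (hκle i).trans (by have := hu1 i; nlinarith)
      exact_mod_cast this
    have hκbig : ∀ i, κ i ≠ 0 → 1 / s < u i := fun i hi => by
      by_contra h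
      exact hi (if_pos (not_lt.1 h))
    have hκF : κ ∈ F := by
      refine Finset.mem_filter.2 ⟨by simpa [Fintype.mem_piFinset, Nat.lt_succ_iff] using hκn,
        ?_, ?_⟩
      · calc ∑ i, (κ i : ℝ) ≤ ∑ i, n / 64 * u i :=
              Finset.sum_le_sum fun i _ => (hκle i).trans_eq (by ring)
          _ ≤ n / 64 := by
              rw [← Finset.mul_sum]
              exact mul_le_of_le_one_right (by positivity) husum
      · -- Chebyshev's inequality
        have : ((Finset.univ.filter fun i => κ i ≠ 0).card : ℝ) * (1 / s) ≤ 1 := by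
          calc ((Finset.univ.filter fun i => κ i ≠ 0).card : ℝ) * (1 / s)
              = ∑ i ∈ Finset.univ.filter fun i => κ i ≠ 0, 1 / s := by simp
            _ ≤ ∑ i ∈ Finset.univ.filter fun i => κ i ≠ 0, u i :=
                Finset.sum_le_sum fun i hi => (hκbig i (Finset.mem_filter.1 hi).2).le
            _ ≤ ∑ i, u i := Finset.sum_le_sum_of_subset_of_nonneg (Finset.subset_univ _)
                fun i _ _ => hu0 i
            _ ≤ 1 := husum
        rwa [mul_one_div, div_le_one hs0] at this
    have hc : ∀ i, ∃ c ∈ C (κ i), NY (T (x i) - c) ≤ 128 ^ d * A * u i ^ b := by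
      intro i
      by_cases hi : u i ≤ 1 / s
      · have hk0 : κ i = 0 := if_pos hi
        refine ⟨0, by rw [hC0 _ hk0]; simp, ?_⟩
        rw [sub_zero]
        have hl0 : 0 < l / n := by positivity
        have hop : 0 ≤ opNorm NX NY T := opNorm_nonneg hX hY.nonneg hT
        calc NY (T (x i)) ≤ opNorm NX NY T * u i ^ d := by
              rw [← hux]; exact le_opNorm hX hY hT _
          _ = opNorm NX NY T * (u i ^ (d - b) * u i ^ b) := by
              rw [← Real.rpow_add_of_nonneg (hu0 i) (by linarith) hb0, sub_add_cancel]
          _ ≤ opNorm NX NY T * ((1 / s) ^ (d - b) * u i ^ b) := by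
              have := hu0 i
              have := Real.rpow_le_rpow (hu0 i) hi (sub_nonneg.2 hbd)
              gcongr
          _ = 64 ^ (d - b) * (opNorm NX NY T * (l / n) ^ (d - b)) * u i ^ b := by
              have : 1 / s = 64 * (l / n) := by rw [hs]; field_simp
              rw [this, Real.mul_rpow (by norm_num) hl0.le]
              ring
          _ ≤ 128 ^ d * A * u i ^ b := by
              have h64 : (64 : ℝ) ^ (d - b) ≤ 128 ^ d :=
                (Real.rpow_le_rpow_of_exponent_le (by norm_num) (by linarith)).trans
                  (Real.rpow_le_rpow (by norm_num) (by norm_num) (hb0.trans hbd))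
              have := Real.rpow_nonneg (hu0 i) b
              rw [hexpo] at h1
              gcongr
      · have hk : κ i = ⌊n * u i / 64⌋₊ := if_neg hi
        have hone : 1 ≤ n * u i / 64 := by
          rw [not_le, div_lt_iff₀ hs0, hs] at hi
          have : u i * (n / (64 * l)) = (n * u i / 64) / l := by field_simp
          rw [this, lt_div_iff₀ (by linarith)] at hi
          linarith
        have hk1 : 1 ≤ κ i := by
          rw [hk]
          exact Nat.le_floor (by simpa using hone)
        have hk1' : (1 : ℝ) ≤ κ i := by exact_mod_cast hk1
        have hlt : n * u i / 64 < κ i + 1 := by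
          rw [hk]; exact Nat.lt_floor_add_one _
        have hule : u i ≤ 128 * κ i / n := by
          rw [le_div_iff₀ hn0]
          linarith
        have hkn : (κ i : ℝ) / n ≤ u i := by
          rw [div_le_iff₀ hn0]
          have := hκle i
          have := mul_nonneg hn0.le (hu0 i)
          linarith
        obtain ⟨c, hc, hcx⟩ := hCcov (κ i) hk1 (hκn i) (x i) (by
          rw [hux]
          exact Real.rpow_le_rpow (hu0 i) hule (hb0.trans hbd))
        refine ⟨c, hc, hcx.trans ?_⟩
        have hkn0 : (0 : ℝ) < κ i / n := by positivity
        calc (128 * κ i / n : ℝ) ^ d * (A * ((κ i : ℝ) / n) ^ (-(d - b)))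
            = 128 ^ d * A * ((κ i / n : ℝ) ^ d * (κ i / n : ℝ) ^ (-(d - b))) := by
              rw [mul_div_assoc, Real.mul_rpow (by norm_num) hkn0.le]
              ring
          _ = 128 ^ d * A * (κ i / n : ℝ) ^ b := by
              rw [← Real.rpow_add hkn0]
              congr 2
              ring
          _ ≤ 128 ^ d * A * u i ^ b := by
              have := Real.rpow_le_rpow hkn0.le hkn hb0
              gcongr
    choose c hcC hcx using hc
    refine ⟨c, Finset.mem_biUnion.2 ⟨κ, hκF, Fintype.mem_piFinset.2 hcC⟩, ?_⟩
    exact lpNorm_le_of_le_mul_rpow hY.nonneg hq (by positivity) hu0 husum hcx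

lemma le_boundA (α : ℝ) (T : X →ₗ[𝕜] Y) {n m k : ℕ} (hk : 1 ≤ k) (hkn : k ≤ n) :
    ((k : ℝ) / n) ^ α * entropy NX NY k T ≤ boundA α NX NY n m T :=
  (le_ciSup (f := fun k : Set.Icc 1 n => (((k : ℕ) : ℝ) / n) ^ α * entropy NX NY (k : ℕ) T)
    (Set.finite_range _).bddAbove ⟨k, hk, hkn⟩).trans (le_max_right _ _)

lemma entropy_diagOp_le_boundA (hX : IsQuasiNorm 𝕜 NX) (hY : IsQuasiNorm 𝕜 NY) {T : X →ₗ[𝕜] Y}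
    (hT : IsBoundedOp NX NY T) {p q : ℝ≥0∞} (hp : 0 < p) (hpq : p < q) {n m : ℕ} (hn : 2 ≤ n)
    (hnm : n ≤ m) : entropy (lpNorm p m NX) (lpNorm q m NY) n (diagOp m T) ≤
      128 ^ (1 / p).toReal * boundA (expo p q) NX NY n m T := by
  have hA : 0 ≤ boundA (expo p q) NX NY n m T :=
    le_trans (mul_nonneg (by positivity) (entropy_nonneg _ _)) (le_boundA _ _ le_rfl (by omega))
  -- `boundA` may vanish, whereas the covering argument needs a positive bound.
  have key : ∀ A > boundA (expo p q) NX NY n m T, entropy (lpNorm p m NX) (lpNorm q m NY) n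
      (diagOp m T) / 128 ^ (1 / p).toReal ≤ A := fun A hAlt => by
    rw [div_le_iff₀' (by positivity)]
    exact entropy_diagOp_le hX hY hT hp hpq hn hnm (hA.trans_lt hAlt)
      ((le_max_left _ _).trans hAlt.le) fun k hk hkn => (le_boundA _ _ hk hkn).trans_lt hAlt
  rw [← div_le_iff₀' (by positivity)]
  exact le_of_forall_gt_imp_ge_of_dense key

end Upper

/-! ### Separated families and codes -/

lemma exists_separated_finset {α : Type*} (P : α → Prop) (R : α → α → Prop)
    (hirr : ∀ x, ¬ R x x) (hsymm : ∀ x y, R x y → R y x) (l : ℕ)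
    (h : ∀ s : Finset α, s.card < l → ∃ x, P x ∧ ∀ y ∈ s, R x y) :
    ∃ s : Finset α, s.card = l ∧ (∀ x ∈ s, P x) ∧ ∀ x ∈ s, ∀ y ∈ s, x ≠ y → R x y := by
  classical
  induction l with
  | zero => exact ⟨∅, by simp⟩
  | succ l ih =>
    obtain ⟨s, hs, hP, hR⟩ := ih fun s hs => h s (by omega)
    obtain ⟨x, hx, hxs⟩ := h s (by omega)
    have hxs' : x ∉ s := fun hmem => hirr x (hxs x hmem)
    refine ⟨insert x s, by rw [Finset.card_insert_of_notMem hxs', hs], ?_, ?_⟩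
    · intro y hy
      rcases Finset.mem_insert.1 hy with rfl | hy
      exacts [hx, hP y hy]
    · intro y hy z hz hyz
      rw [Finset.mem_insert] at hy hz
      rcases hy with rfl | hy <;> rcases hz with rfl | hz
      · exact absurd rfl hyz
      · exact hxs z hz
      · exact hsymm _ _ (hxs y hy)
      · exact hR y hy z hz hyz

/-- The size of a Hamming ball of radius just below half the word length, for an alphabet with
`4 ^ j` letters. -/
lemma card_hamming_ball_le (j M : ℕ) (w : Fin M → Fin (4 ^ j)) :
    (Finset.univ.filter fun v => 2 * hammingDist v w < M).card ≤ 2 ^ (M + j * M) := by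
  set c : ℝ := (1 / 4) ^ j with hc
  have hc0 : 0 < c := by positivity
  set g : (i : Fin M) → Fin (4 ^ j) → ℝ := fun i a => if a = w i then 1 else c with hg
  have hg0 : ∀ i a, 0 ≤ g i a := fun i a => by simp only [hg]; split_ifs <;> positivity
  have hball : ∀ v ∈ Finset.univ.filter fun v => 2 * hammingDist v w < M,
      (1 : ℝ) ≤ 2 ^ (j * M) * ∏ i, g i (v i) := by
    intro v hv
    have hd := (Finset.mem_filter.1 hv).2
    have : ∏ i, g i (v i) = c ^ hammingDist v w := by
      simp only [hg, Finset.prod_ite, Finset.prod_const, one_pow, one_mul, hammingDist, ne_eq]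
    rw [this, hc, ← pow_mul, show (1 / 4 : ℝ) = (1 / 2) ^ 2 by norm_num, ← pow_mul]
    calc (1 : ℝ) = 2 ^ (j * M) * (1 / 2) ^ (j * M) := by rw [← mul_pow]; norm_num
      _ ≤ _ := by
        refine mul_le_mul_of_nonneg_left ?_ (by positivity)
        refine pow_le_pow_of_le_one (by norm_num) (by norm_num) ?_
        calc 2 * (j * hammingDist v w) = j * (2 * hammingDist v w) := by ring
          _ ≤ j * M := Nat.mul_le_mul_left j hd.le
  have hsum : ∀ i, ∑ a, g i a ≤ 2 := by
    intro i
    calc ∑ a, g i a ≤ ∑ a, ((if a = w i then 1 else 0) + c) := by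
          refine Finset.sum_le_sum fun a _ => ?_
          simp only [hg]
          split_ifs <;> linarith
      _ = 2 := by
          have : (4 : ℝ) ^ j * c = 1 := by rw [hc, ← mul_pow]; norm_num
          rw [Finset.sum_add_distrib]
          simp only [Finset.sum_ite_eq', Finset.mem_univ, if_true, Finset.sum_const,
            Finset.card_univ, Fintype.card_fin, nsmul_eq_mul, Nat.cast_pow, Nat.cast_ofNat, this]
          norm_num
  have : ((Finset.univ.filter fun v => 2 * hammingDist v w < M).card : ℝ) ≤ 2 ^ (M + j * M) := by
    calc ((Finset.univ.filter fun v => 2 * hammingDist v w < M).card : ℝ)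
        = ∑ v ∈ Finset.univ.filter fun v => 2 * hammingDist v w < M, (1 : ℝ) := by simp
      _ ≤ ∑ v ∈ Finset.univ.filter fun v => 2 * hammingDist v w < M,
            2 ^ (j * M) * ∏ i, g i (v i) := Finset.sum_le_sum hball
      _ ≤ ∑ v : Fin M → Fin (4 ^ j), 2 ^ (j * M) * ∏ i, g i (v i) :=
          Finset.sum_le_sum_of_subset_of_nonneg (Finset.subset_univ _) fun v _ _ =>
            mul_nonneg (by positivity) (Finset.prod_nonneg fun i _ => hg0 i _)
      _ = 2 ^ (j * M) * ∏ i, ∑ a, g i a := by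
          rw [← Finset.mul_sum, Finset.prod_univ_sum, Fintype.piFinset_univ]
      _ ≤ 2 ^ (j * M) * ∏ _i : Fin M, (2 : ℝ) := by
          refine mul_le_mul_of_nonneg_left ?_ (by positivity)
          exact Finset.prod_le_prod (fun i _ => Finset.sum_nonneg fun a _ => hg0 i a)
            fun i _ => hsum i
      _ = 2 ^ (M + j * M) := by simp [pow_add, mul_comm]
  exact_mod_cast this

/-- The Gilbert–Varshamov bound, for words of length `M` in an alphabet with `4 ^ j` letters and
distance at least half the length. -/
lemma exists_code {j M n : ℕ} (hj : 1 ≤ j) (hM : 1 ≤ M) (hn : n ≤ (j - 1) * M) :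
    ∃ W : Finset (Fin M → Fin (4 ^ j)), W.card = 2 ^ n ∧
      ∀ v ∈ W, ∀ w ∈ W, v ≠ w → M ≤ 2 * hammingDist v w := by
  have hfree : ∀ s : Finset (Fin M → Fin (4 ^ j)), s.card < 2 ^ n →
      ∃ v, True ∧ ∀ w ∈ s, M ≤ 2 * hammingDist v w := by
    intro s hs
    by_contra! hcon
    have hcover : (Finset.univ : Finset (Fin M → Fin (4 ^ j))) ⊆
        s.biUnion fun w => Finset.univ.filter fun v => 2 * hammingDist v w < M := by
      intro v _
      obtain ⟨w, hw, hvw⟩ := hcon v trivial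
      exact Finset.mem_biUnion.2 ⟨w, hw, by simpa using hvw⟩
    have h1 := (Finset.card_le_card hcover).trans
      (Finset.card_biUnion_le_card_mul _ _ _ fun w _ => card_hamming_ball_le j M w)
    have h2 : s.card * 2 ^ (M + j * M) < 2 ^ n * 2 ^ (M + j * M) :=
      Nat.mul_lt_mul_of_pos_right hs (by positivity)
    have h3 : 2 ^ n * 2 ^ (M + j * M) ≤ (4 ^ j) ^ M := by
      rw [← pow_add, show 4 = 2 ^ 2 by norm_num, ← pow_mul, ← pow_mul]
      refine Nat.pow_le_pow_right (by norm_num) ?_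
      obtain ⟨i, rfl⟩ := Nat.exists_eq_add_of_le' hj
      simp only [Nat.add_sub_cancel] at hn
      nlinarith
    simp at h1
    omega
  obtain ⟨W, hW, -, hR⟩ := exists_separated_finset (fun _ : Fin M → Fin (4 ^ j) => True)
    (fun v w => M ≤ 2 * hammingDist v w) (fun v => by rw [hammingDist_self]; omega)
    (fun v w h => by rwa [hammingDist_comm]) (2 ^ n) hfree
  exact ⟨W, hW, hR⟩

/-! ### The lower bound -/

section Sequence

variable {X : Type*} {N : X → ℝ} {m : ℕ} {q : ℝ≥0∞}

lemma le_lpNorm (hN : ∀ x, 0 ≤ N x) (hq : 0 < q) (x : Fin m → X) (i : Fin m) :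
    N (x i) ≤ lpNorm q m N x := by
  by_cases hq' : q = ∞
  · rw [lpNorm, if_pos hq']
    exact le_ciSup (f := fun i => N (x i)) (Set.finite_range _).bddAbove i
  · have hq0 := ENNReal.toReal_pos hq.ne' hq'
    have h0 : 0 ≤ lpNorm q m N x := by
      rw [lpNorm, if_neg hq']
      exact Real.rpow_nonneg (Finset.sum_nonneg fun i _ => Real.rpow_nonneg (hN _) _) _
    have h1 := (lpNorm_le_iff hN hq hq' x h0).1 le_rfl
    exact (Real.rpow_le_rpow_iff (hN _) h0 hq0).1 ((Finset.single_le_sum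
      (f := fun i => N (x i) ^ q.toReal) (fun i _ => Real.rpow_nonneg (hN _) _)
      (Finset.mem_univ i)).trans h1)

lemma lpNorm_nonneg (hN : ∀ x, 0 ≤ N x) (x : Fin m → X) : 0 ≤ lpNorm q m N x := by
  rw [lpNorm]
  split_ifs
  · exact Real.iSup_nonneg fun i => hN _
  · exact Real.rpow_nonneg (Finset.sum_nonneg fun i _ => Real.rpow_nonneg (hN _) _) _

lemma rpow_lpNorm (hN : ∀ x, 0 ≤ N x) (hq : 0 < q) (hq' : q ≠ ∞) (x : Fin m → X) :
    lpNorm q m N x ^ q.toReal = ∑ i, N (x i) ^ q.toReal := by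
  have hq0 := ENNReal.toReal_pos hq.ne' hq'
  rw [lpNorm, if_neg hq', one_div, Real.rpow_inv_rpow
    (Finset.sum_nonneg fun i _ => Real.rpow_nonneg (hN _) _) hq0.ne']

lemma lpNorm_fin_one (hN : ∀ x, 0 ≤ N x) (hq : 0 < q) (x : Fin 1 → X) :
    lpNorm q 1 N x = N (x 0) := by
  refine le_antisymm ?_ (le_lpNorm hN hq x 0)
  by_cases hq' : q = ∞
  · subst hq'
    rw [lpNorm_top_le_iff _ (hN _)]
    exact fun i => by rw [Subsingleton.elim i 0]
  · rw [lpNorm_le_iff hN hq hq' _ (hN _)]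
    simp

end Sequence

section Lower

variable {𝕜 X Y : Type*} [RCLike 𝕜] [AddCommGroup X] [Module 𝕜 X]
    [AddCommGroup Y] [Module 𝕜 Y] {NX : X → ℝ} {NY : Y → ℝ}

/-- The vector of `X ^ m` whose block with number `t` is `z t`, and which vanishes outside the `M`
blocks of length `b` placed by `φ`. -/
noncomputable def concat {M b m : ℕ} (φ : Fin M × Fin b → Fin m) (z : Fin M → Fin b → X) : Fin m → X :=
  Function.extend φ (fun tu => z tu.1 tu.2) 0

lemma sum_concat {M b m : ℕ} {φ : Fin M × Fin b → Fin m} (hφ : Function.Injective φ)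
    (z : Fin M → Fin b → X) {f : X → ℝ} (hf : f 0 = 0) :
    ∑ i, f (concat φ z i) = ∑ t, ∑ u, f (z t u) := by
  rw [← Fintype.sum_prod_type' (f := fun t u => f (z t u))]
  symm
  refine Fintype.sum_of_injective φ hφ _ _ (fun i hi => ?_) fun tu => ?_
  · rw [concat, Function.extend_apply' _ _ _ (by simpa using hi), Pi.zero_apply, hf]
  · rw [concat, hφ.extend_apply]

lemma diagOp_concat_sub {M b m : ℕ} {φ : Fin M × Fin b → Fin m} (hφ : Function.Injective φ)
    (T : X →ₗ[𝕜] Y) (z z' : Fin M → Fin b → X) :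
    diagOp m T (concat φ z) - diagOp m T (concat φ z') =
      concat φ fun t u => T (z t u) - T (z' t u) := by
  funext i
  simp only [Pi.sub_apply, diagOp_apply]
  by_cases hi : ∃ tu, φ tu = i
  · obtain ⟨tu, rfl⟩ := hi
    simp only [concat, hφ.extend_apply]
  · simp only [concat, Function.extend_apply' _ _ _ hi, Pi.zero_apply, map_zero, sub_zero]

lemma lpNorm_concat_le (hX : IsQuasiNorm 𝕜 NX) {p : ℝ≥0∞} (hp : 0 < p) (hp' : p ≠ ∞)
    {M b m : ℕ} (hM : 1 ≤ M) {φ : Fin M × Fin b → Fin m} (hφ : Function.Injective φ)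
    (z : Fin M → Fin b → X) (hz : ∀ t, lpNorm p b NX (z t) ≤ 1) :
    lpNorm p m NX (concat φ fun t u => (((M : ℝ) ^ (-(1 / p).toReal) : ℝ) : 𝕜) • z t u) ≤ 1 := by
  have hp0 := ENNReal.toReal_pos hp.ne' hp'
  have hM0 : (0 : ℝ) < M := by exact_mod_cast hM
  rw [lpNorm_le_iff hX.nonneg hp hp' _ zero_le_one, Real.one_rpow,
    sum_concat hφ _ (f := fun x => NX x ^ p.toReal) (by simp [hX.zero, hp0.ne'])]
  calc ∑ t, ∑ u, NX ((((M : ℝ) ^ (-(1 / p).toReal) : ℝ) : 𝕜) • z t u) ^ p.toReal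
      = ∑ t, (M : ℝ)⁻¹ * ∑ u, NX (z t u) ^ p.toReal := by
        refine Finset.sum_congr rfl fun t _ => ?_
        rw [Finset.mul_sum]
        refine Finset.sum_congr rfl fun u _ => ?_
        rw [norm_ofReal_smul hX (by positivity), Real.mul_rpow (by positivity) (hX.nonneg _),
          ← Real.rpow_mul hM0.le, neg_mul, toReal_one_div hp hp', Real.rpow_neg_one]
    _ ≤ ∑ _t : Fin M, (M : ℝ)⁻¹ * 1 := by
        refine Finset.sum_le_sum fun t _ => mul_le_mul_of_nonneg_left ?_ (by positivity)
        simpa using (lpNorm_le_iff hX.nonneg hp hp' _ zero_le_one).1 (hz t)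
    _ = 1 := by simp [hM0.ne']

lemma le_lpNorm_concat (hY : IsQuasiNorm 𝕜 NY) {q : ℝ≥0∞} (hq : 0 < q)
    {M b m : ℕ} (hM : 1 ≤ M) {φ : Fin M × Fin b → Fin m} (hφ : Function.Injective φ)
    (z : Fin M → Fin b → Y) {δ : ℝ} (hδ : 0 ≤ δ) (S : Finset (Fin M)) (hS : M ≤ 2 * S.card)
    (hz : ∀ t ∈ S, δ ≤ lpNorm q b NY (z t)) :
    ((M : ℝ) / 2) ^ (1 / q).toReal * δ ≤ lpNorm q m NY (concat φ z) := by
  by_cases hq' : q = ∞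
  · subst hq'
    have hS0 : S.Nonempty := Finset.card_pos.1 (by omega)
    obtain ⟨t, ht⟩ := hS0
    simp only [ENNReal.div_top, ENNReal.toReal_zero, Real.rpow_zero, one_mul]
    refine (hz t ht).trans ((lpNorm_top_le_iff _ (lpNorm_nonneg hY.nonneg _)).2 fun u => ?_)
    have := le_lpNorm hY.nonneg hq (concat φ z) (φ (t, u))
    rwa [concat, hφ.extend_apply] at this
  · have hq0 := ENNReal.toReal_pos hq.ne' hq'
    have hM2 : (M : ℝ) / 2 ≤ S.card := by
      rw [div_le_iff₀' (by norm_num)]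
      exact_mod_cast hS
    rw [← Real.rpow_le_rpow_iff (by positivity) (lpNorm_nonneg hY.nonneg _) hq0,
      rpow_lpNorm hY.nonneg hq hq', Real.mul_rpow (by positivity) hδ,
      ← Real.rpow_mul (by positivity), toReal_one_div hq hq', Real.rpow_one,
      sum_concat hφ _ (f := fun x => NY x ^ q.toReal) (by simp [hY.zero, hq0.ne'])]
    calc (M : ℝ) / 2 * δ ^ q.toReal ≤ S.card * δ ^ q.toReal := by gcongr
      _ = ∑ t ∈ S, δ ^ q.toReal := by simp
      _ ≤ ∑ t ∈ S, ∑ u, NY (z t u) ^ q.toReal := by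
          refine Finset.sum_le_sum fun t ht => ?_
          rw [← rpow_lpNorm hY.nonneg hq hq']
          exact Real.rpow_le_rpow hδ (hz t ht) hq0.le
      _ ≤ ∑ t, ∑ u, NY (z t u) ^ q.toReal :=
          Finset.sum_le_sum_of_subset_of_nonneg (Finset.subset_univ _) fun t _ _ =>
            Finset.sum_nonneg fun u _ => Real.rpow_nonneg (hY.nonneg _) _

/-- A constant that depends only on `p`, `q` and `r`. -/
noncomputable def sepConst (p q : ℝ≥0∞) (r : ℝ) : ℝ :=
  2 ^ ((1 / p).toReal + (1 / r + (1 / q).toReal))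

lemma sepConst_pos (p q : ℝ≥0∞) (r : ℝ) : 0 < sepConst p q r := by
  unfold sepConst; positivity

lemma expo_pos {p q : ℝ≥0∞} (hp : 0 < p) (hpq : p < q) : 0 < expo p q := by
  refine sub_pos.2 (ENNReal.toReal_strict_mono (by simp [hp.ne']) ?_)
  simpa using hpq

/-- The common source of all lower bounds. Given `4 ^ j` vectors in the unit ball of `l_p^b(X)`
whose images are `δ`-separated in `l_q^b(Y)`, place them as the letters of the words of a code of
length about `n / (j - 1)`: the resulting more than `2 ^ (n - 1)` vectors of `l_p^m(X)` have
separated images. -/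
lemma le_entropy_diagOp {r : ℝ} (hr : 0 < r) (hX : IsQuasiNorm 𝕜 NX) (hY : IsRBanach 𝕜 r NY)
    {T : X →ₗ[𝕜] Y} (hT : IsBoundedOp NX NY T) {p q : ℝ≥0∞} (hp : 0 < p) (hpq : p < q)
    {n m j b : ℕ} (hn : 1 ≤ n) (hj : 2 ≤ j) (hjn : j - 1 ≤ n) (hb : n * b ≤ m)
    (a : Fin (4 ^ j) → Fin b → X) (ha : ∀ i, lpNorm p b NX (a i) ≤ 1) {δ : ℝ} (hδ : 0 ≤ δ)
    (hsep : ∀ i i', i ≠ i' → δ ≤ lpNorm q b NY fun u => T (a i u) - T (a i' u)) :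
    δ * (((j - 1 : ℕ) : ℝ) / n) ^ expo p q ≤
      sepConst p q r * entropy (lpNorm p m NX) (lpNorm q m NY) n (diagOp m T) := by
  have hq : 0 < q := hp.trans hpq
  have hp' : p ≠ ∞ := hpq.ne_top
  have hY' : IsQuasiNorm 𝕜 NY := hY.toIsQuasiNorm
  have hα := expo_pos hp hpq
  set d := (1 / p).toReal with hd
  set β := (1 / q).toReal with hβ
  have hexpo : expo p q = d - β := rfl
  set k := j - 1 with hk
  have hk1 : 1 ≤ k := by omega
  -- The number of blocks is `⌈n / k⌉`.
  set M := (n + k - 1) / k with hMdef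
  have hMlow : n ≤ k * M := by
    have h1 := Nat.div_add_mod (n + k - 1) k
    have h2 := Nat.mod_lt (n + k - 1) (show 0 < k by omega)
    rw [← hMdef] at h1
    omega
  have hMup : k * M ≤ 2 * n := (Nat.mul_div_le _ _).trans (by omega)
  have hM1 : 1 ≤ M := Nat.pos_of_ne_zero fun h => by rw [h] at hMlow; omega
  have hMn : M ≤ n := by
    rw [hMdef]
    refine Nat.div_le_of_le_mul ?_
    obtain ⟨k', hk'⟩ := Nat.exists_eq_add_of_le' hk1
    obtain ⟨n', rfl⟩ := Nat.exists_eq_add_of_le' hn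
    rw [hk']
    have : n' + 1 + (k' + 1) - 1 = n' + 1 + k' := by omega
    rw [this]
    nlinarith [Nat.zero_le (k' * n')]
  obtain ⟨W, hW, hdist⟩ := exists_code (j := j) (by omega) hM1 hMlow
  obtain ⟨φ⟩ : Nonempty (Fin M × Fin b ↪ Fin m) := by
    refine Function.Embedding.nonempty_of_card_le ?_
    simpa using (Nat.mul_le_mul_right b hMn).trans hb
  have hφ := φ.injective
  set c : ℝ := (M : ℝ) ^ (-d) with hc
  have hM0 : (0 : ℝ) < M := by exact_mod_cast hM1
  have hc0 : 0 < c := by positivity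
  have hsepW : ((M : ℝ) / 2) ^ β * (c * δ) ≤ 2 ^ (1 / r + β) *
      entropy (lpNorm p m NX) (lpNorm q m NY) n (diagOp m T) := by
    refine le_entropy_of_separated (exists_bound_diagOp hX hY' hT hp hq m) (by positivity)
      (fun hε hx hy => lpNorm_sub_le hr hY hq hε hx hy) (ι := W) ?_
      (fun w => concat φ fun t u => (c : 𝕜) • a (w.1 t) u)
      (fun w => lpNorm_concat_le hX hp hp' hM1 hφ _ fun t => ha _) ?_
    · rw [Fintype.card_coe, hW]
      exact Nat.pow_lt_pow_right (by norm_num) (by omega)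
    · intro v w hvw
      rw [diagOp_concat_sub hφ]
      refine le_lpNorm_concat hY' hq hM1 hφ _ (by positivity)
        (Finset.univ.filter fun t => v.1 t ≠ w.1 t)
        (hdist v.1 v.2 w.1 w.2 fun h => hvw (Subtype.ext h)) fun t ht => ?_
      have h1 := hsep _ _ (Finset.mem_filter.1 ht).2
      have h2 : ∀ u, NY (T ((c : 𝕜) • a (v.1 t) u) - T ((c : 𝕜) • a (w.1 t) u)) =
          c * NY (T (a (v.1 t) u) - T (a (w.1 t) u)) := fun u => by
        rw [map_smul, map_smul, ← smul_sub, norm_ofReal_smul hY' hc0.le]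
      rw [← le_div_iff₀' hc0]
      refine h1.trans ?_
      have h3 : 0 ≤ lpNorm q b NY fun u => T ((c : 𝕜) • a (v.1 t) u) - T ((c : 𝕜) • a (w.1 t) u) :=
        lpNorm_nonneg hY'.nonneg _
      by_cases hq' : q = ∞
      · subst hq'
        rw [lpNorm_top_le_iff _ (by positivity)]
        intro u
        rw [le_div_iff₀' hc0, ← h2]
        exact (lpNorm_top_le_iff _ h3).1 le_rfl u
      · rw [lpNorm_le_iff hY'.nonneg hq hq' _ (by positivity), Real.div_rpow h3 hc0.le,
          rpow_lpNorm hY'.nonneg hq hq', le_div_iff₀' (by positivity), Finset.mul_sum]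
        refine Finset.sum_le_sum fun u _ => ?_
        rw [h2, Real.mul_rpow hc0.le (hY'.nonneg _)]
  have hn0 : (0 : ℝ) < n := by exact_mod_cast hn
  have hk0 : (0 : ℝ) < k := by exact_mod_cast hk1
  have hkM : (k : ℝ) / n ≤ 2 / M := by
    rw [div_le_div_iff₀ hn0 hM0]
    exact_mod_cast hMup
  calc δ * ((k : ℝ) / n) ^ expo p q ≤ δ * (2 / M) ^ expo p q := by gcongr
    _ = 2 ^ d * (((M : ℝ) / 2) ^ β * (c * δ)) := by
        rw [hexpo, hc, Real.div_rpow (by norm_num) hM0.le, Real.div_rpow hM0.le (by norm_num),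
          Real.rpow_sub (by norm_num), Real.rpow_sub hM0, Real.rpow_neg hM0.le]
        field_simp
    _ ≤ 2 ^ d * (2 ^ (1 / r + β) *
          entropy (lpNorm p m NX) (lpNorm q m NY) n (diagOp m T)) := by gcongr
    _ = _ := by rw [← mul_assoc, ← Real.rpow_add (by norm_num)]; rfl

section Instances

variable {r : ℝ} {T : X →ₗ[𝕜] Y} {p q : ℝ≥0∞} {n m : ℕ}

lemma opNorm_mul_le (hX : IsQuasiNorm 𝕜 NX) {c R : ℝ} (hc : 0 ≤ c)
    (h : ∀ x, NX x ≤ 1 → NY (T x) * c ≤ R) : opNorm NX NY T * c ≤ R := by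
  have hR0 : 0 ≤ NY (T 0) * c → 0 ≤ R := fun h0 => h0.trans (h 0 (by simp [hX.zero]))
  rcases hc.eq_or_lt with rfl | hc
  · simpa using hR0 (by simp)
  · rw [← le_div_iff₀ hc]
    refine csSup_le ⟨_, 0, by simp [qball, hX.zero], rfl⟩ ?_
    rintro _ ⟨x, hx, rfl⟩
    rw [le_div_iff₀ hc]
    exact h x (by simpa [qball] using hx)

/-- The alphabet consists of multiples of one vector. -/
lemma opNorm_le_entropy (hr : 0 < r) (hX : IsQuasiNorm 𝕜 NX) (hY : IsRBanach 𝕜 r NY)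
    (hT : IsBoundedOp NX NY T) (hp : 0 < p) (hpq : p < q) (hn : 1 ≤ n) (hnm : n ≤ m) :
    opNorm NX NY T * (1 / (n : ℝ)) ^ expo p q ≤ 16 * (sepConst p q r *
      entropy (lpNorm p m NX) (lpNorm q m NY) n (diagOp m T)) := by
  refine opNorm_mul_le hX (by positivity) fun x hx => ?_
  have hq : 0 < q := hp.trans hpq
  have hY' : IsQuasiNorm 𝕜 NY := hY.toIsQuasiNorm
  have key := le_entropy_diagOp hr hX hY hT hp hpq (j := 2) (b := 1) (m := m) hn le_rfl hn
    (by omega) (fun i _ => ((((i : ℕ) : ℝ) / 16 : ℝ) : 𝕜) • x) (fun i => ?_)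
    (δ := 1 / 16 * NY (T x)) (mul_nonneg (by norm_num) (hY'.nonneg _)) fun i i' hii' => ?_
  · norm_num at key ⊢
    linarith
  · rw [lpNorm_fin_one hX.nonneg hp, norm_ofReal_smul hX (by positivity)]
    have hi : ((i : ℕ) : ℝ) ≤ 16 := by exact_mod_cast i.2.le
    have : ((i : ℕ) : ℝ) / 16 ≤ 1 := by linarith
    exact mul_le_one₀ this (hX.nonneg x) hx
  · rw [lpNorm_fin_one hY'.nonneg hq, map_smul, map_smul, ← sub_smul, ← RCLike.ofReal_sub,
      hY'.smul, RCLike.norm_ofReal]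
    refine mul_le_mul_of_nonneg_right ?_ (hY'.nonneg _)
    rw [← sub_div, abs_div, abs_of_pos (by norm_num : (0 : ℝ) < 16)]
    have h1 : ((i : ℕ) : ℤ) - ((i' : ℕ) : ℤ) ≠ 0 := by
      intro h
      exact hii' (Fin.ext (by omega))
    have h2 := Int.one_le_abs h1
    have h3 : (1 : ℝ) ≤ |((i : ℕ) : ℝ) - ((i' : ℕ) : ℝ)| := by exact_mod_cast h2
    linarith

/-- The alphabet consists of points of the unit ball of `X` with separated images. -/
lemma entropy_mul_le_entropy_of_le (hr : 0 < r) (hX : IsQuasiNorm 𝕜 NX) (hY : IsRBanach 𝕜 r NY)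
    (hT : IsBoundedOp NX NY T) (hp : 0 < p) (hpq : p < q) (hnm : n ≤ m) {k : ℕ} (hk : 5 ≤ k)
    (hkn : k ≤ n) :
    entropy NX NY k T * ((((k - 1) / 2 - 1 : ℕ) : ℝ) / n) ^ expo p q ≤ sepConst p q r *
      entropy (lpNorm p m NX) (lpNorm q m NY) n (diagOp m T) := by
  classical
  have hq : 0 < q := hp.trans hpq
  have hY' : IsQuasiNorm 𝕜 NY := hY.toIsQuasiNorm
  set j := (k - 1) / 2 with hj
  have hj2 : 2 ≤ j := by omega
  have hn0 : (0 : ℝ) < n := by exact_mod_cast (show 0 < n by omega)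
  have hj0 : (0 : ℝ) < (j - 1 : ℕ) := by exact_mod_cast (show 0 < j - 1 by omega)
  rw [← le_div_iff₀ (by positivity)]
  refine le_of_forall_lt_imp_le_of_dense fun δ hδ => ?_
  rcases le_or_gt δ 0 with hδ0 | hδ0
  · exact hδ0.trans (div_nonneg (mul_nonneg (sepConst_pos _ _ _).le (entropy_nonneg _ _))
      (by positivity))
  rw [le_div_iff₀ (by positivity)]
  obtain ⟨s, hs, hs1, hsep⟩ := exists_separated_finset (fun x => NX x ≤ 1)
    (fun x y => δ < NY (T x - T y)) (fun x => by simpa [hY'.zero] using hδ0.le)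
    (fun x y h => by rwa [← hY'.neg, neg_sub]) (4 ^ j) (by
      intro s hs
      by_contra! hcon
      refine hδ.not_ge (entropy_le_of_finset hδ0 (s.image T) ?_ fun x hx => ?_)
      · calc (s.image T).card ≤ 4 ^ j := Finset.card_image_le.trans hs.le
          _ = 2 ^ (2 * j) := by rw [pow_mul]; norm_num
          _ ≤ 2 ^ (k - 1) := Nat.pow_le_pow_right (by norm_num) (by omega)
      · obtain ⟨y, hy, hxy⟩ := hcon x hx
        exact ⟨T y, Finset.mem_image_of_mem _ hy, hxy⟩)
  let e := (s.equivFinOfCardEq hs).symm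
  refine le_entropy_diagOp hr hX hY hT hp hpq (j := j) (b := 1) (by omega) hj2
    (by omega) (by omega) (fun i _ => (e i : X)) (fun i => ?_) hδ0.le fun i i' hii' => ?_
  · rw [lpNorm_fin_one hX.nonneg hp]
    exact hs1 _ (e i).2
  · rw [lpNorm_fin_one hY'.nonneg hq]
    exact (hsep _ (e i).2 _ (e i').2 fun h => hii' (e.injective (Subtype.ext h))).le

/-- The alphabet consists of the unit vectors `(0, …, 0, x, 0, …, 0)` of length `4 ^ j`. -/
lemma opNorm_mul_le_entropy_of_le (hr : 0 < r) (hX : IsQuasiNorm 𝕜 NX) (hY : IsRBanach 𝕜 r NY)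
    (hT : IsBoundedOp NX NY T) (hp : 0 < p) (hpq : p < q) (hn : 1 ≤ n) {j : ℕ} (hj : 2 ≤ j)
    (hjn : j - 1 ≤ n) (hjm : n * 4 ^ j ≤ m) :
    opNorm NX NY T * (((j - 1 : ℕ) : ℝ) / n) ^ expo p q ≤ sepConst p q r *
      entropy (lpNorm p m NX) (lpNorm q m NY) n (diagOp m T) := by
  refine opNorm_mul_le hX (by positivity) fun x hx => ?_
  have hq : 0 < q := hp.trans hpq
  have hp' : p ≠ ∞ := hpq.ne_top
  have hp0 := ENNReal.toReal_pos hp.ne' hp'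
  have hY' : IsQuasiNorm 𝕜 NY := hY.toIsQuasiNorm
  refine le_entropy_diagOp hr hX hY hT hp hpq hn hj hjn hjm (fun i => Pi.single i x)
    (fun i => ?_) (hY'.nonneg _) fun i i' hii' => ?_
  · rw [lpNorm_le_iff hX.nonneg hp hp' _ zero_le_one, Real.one_rpow, Finset.sum_eq_single i]
    · simpa using Real.rpow_le_one (hX.nonneg x) hx hp0.le
    · intro u _ hu
      simp [hu, hX.zero, hp0.ne']
    · simp
  · refine le_trans ?_ (le_lpNorm hY'.nonneg hq _ i)
    simp [hii']

end Instances

lemma boundA_le {r : ℝ} (hr : 0 < r) (hX : IsQuasiNorm 𝕜 NX) (hY : IsRBanach 𝕜 r NY)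
    {T : X →ₗ[𝕜] Y} (hT : IsBoundedOp NX NY T) {p q : ℝ≥0∞} (hp : 0 < p) (hpq : p < q)
    {n m : ℕ} (hn : 2 ≤ n) (hnm : n ≤ m) (hm : m ≤ 2 ^ n) :
    boundA (expo p q) NX NY n m T ≤ 7 ^ expo p q * (16 * (sepConst p q r *
      entropy (lpNorm p m NX) (lpNorm q m NY) n (diagOp m T))) := by
  have hα := expo_pos hp hpq
  have hL := one_le_logRatio (by omega) hnm
  have hY' : IsQuasiNorm 𝕜 NY := hY.toIsQuasiNorm
  have hop := opNorm_nonneg hX hY'.nonneg hT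
  have hbase := opNorm_le_entropy hr hX hY hT hp hpq (by omega) hnm
  have hcard := fun {j : ℕ} => opNorm_mul_le_entropy_of_le hr hX hY hT hp hpq
    (m := m) (show 1 ≤ n by omega) (j := j)
  have hent := fun {k : ℕ} => entropy_mul_le_entropy_of_le hr hX hY hT hp hpq hnm (k := k)
  set E := sepConst p q r * entropy (lpNorm p m NX) (lpNorm q m NY) n (diagOp m T) with hE
  have hE0 : 0 ≤ E := mul_nonneg (sepConst_pos _ _ _).le (entropy_nonneg _ _)
  have hn0 : (0 : ℝ) < n := by exact_mod_cast (show 0 < n by omega)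
  -- Every term of the maximum is of the form `(v / n) ^ α * z` with `v ≤ 7 w`.
  have hmono : ∀ {v w z : ℝ}, 0 ≤ v → v ≤ 7 * w → 0 ≤ z → z * (w / n) ^ expo p q ≤ 16 * E →
      z * (v / n) ^ expo p q ≤ 7 ^ expo p q * (16 * E) := by
    intro v w z hv hvw hz h
    have hw : 0 ≤ w := by linarith
    calc z * (v / n) ^ expo p q ≤ z * (7 * (w / n)) ^ expo p q := by
          have : v / n ≤ 7 * (w / n) := by
            rw [← mul_div_assoc]
            gcongr
          gcongr
      _ = 7 ^ expo p q * (z * (w / n) ^ expo p q) := by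
          rw [Real.mul_rpow (by norm_num) (by positivity)]
          ring
      _ ≤ _ := by gcongr
  have h16 : E ≤ 16 * E := by linarith
  refine max_le ?_ (Real.iSup_le (fun k => ?_) (by positivity))
  · change opNorm NX NY T * (logRatio n m / n) ^ expo p q ≤ _
    set j := Nat.log 4 (m / n) with hj
    have hmn : m / n ≠ 0 := (Nat.div_pos hnm (by omega)).ne'
    have hlow : 4 ^ j ≤ m / n := Nat.pow_log_le_self 4 hmn
    have hup : m / n < 4 ^ (j + 1) := Nat.lt_pow_succ_log_self (by norm_num) _
    have hLj : logRatio n m ≤ 2 * j + 3 := by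
      have h1 : (m : ℝ) / n ≤ 2 ^ ((2 * j + 2 : ℕ) : ℝ) := by
        rw [Real.rpow_natCast, div_le_iff₀ hn0]
        have h2 : m < 4 ^ (j + 1) * n := (Nat.div_lt_iff_lt_mul (by omega)).1 hup
        have h3 : (4 : ℕ) ^ (j + 1) = 2 ^ (2 * j + 2) := by
          rw [show 2 * j + 2 = 2 * (j + 1) by ring, pow_mul]; norm_num
        rw [h3] at h2
        exact_mod_cast h2.le
      have h4 : Real.logb 2 ((m : ℝ) / n) ≤ ((2 * j + 2 : ℕ) : ℝ) := by
        rw [Real.logb_le_iff_le_rpow (by norm_num)]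
        · exact h1
        · have : (0 : ℝ) < m := by exact_mod_cast (show 0 < m by omega)
          positivity
      push_cast at h4
      unfold logRatio
      linarith
    rcases le_or_gt 2 j with hj2 | hj2
    · refine hmono (w := (j - 1 : ℕ)) (by linarith) ?_ hop ((hcard hj2 ?_ ?_).trans h16)
      · rw [Nat.cast_sub (by omega)]
        have : (2 : ℝ) ≤ j := by exact_mod_cast hj2
        push_cast
        linarith
      · have h1 : 2 ^ j ≤ 2 ^ n := by
          calc 2 ^ j ≤ 4 ^ j := Nat.pow_le_pow_left (by norm_num) j
            _ ≤ m / n := hlow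
            _ ≤ m := Nat.div_le_self m n
            _ ≤ 2 ^ n := hm
        have := (Nat.pow_le_pow_iff_right (by norm_num)).1 h1
        omega
      · calc n * 4 ^ j ≤ n * (m / n) := Nat.mul_le_mul_left n hlow
          _ ≤ m := Nat.mul_div_le m n
    · refine hmono (w := 1) (by linarith) ?_ hop hbase
      have : (j : ℝ) ≤ 1 := by exact_mod_cast (show j ≤ 1 by omega)
      linarith
  · obtain ⟨k, hk1, hkn⟩ := k
    simp only
    rw [mul_comm]
    rcases le_or_gt 5 k with hk5 | hk5
    · refine hmono (w := ((k - 1) / 2 - 1 : ℕ)) (by positivity) ?_ (entropy_nonneg _ _)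
        ((hent hk5 hkn).trans h16)
      exact_mod_cast (show k ≤ 7 * ((k - 1) / 2 - 1) by omega)
    · refine hmono (w := 1) (by positivity) ?_ (entropy_nonneg _ _) ?_
      · have : (k : ℝ) ≤ 4 := by exact_mod_cast (show k ≤ 4 by omega)
        linarith
      · refine le_trans ?_ hbase
        have := entropy_le_opNorm hX hY'.nonneg k hT
        gcongr

end Lower

end QuasiEntropy

theorem theorem3p2 (p q : ℝ≥0∞) (r : ℝ) (hp : 0 < p) (hpq : p < q) (hr : 0 < r) (hr1 : r ≤ 1) :
    ∃ c₁ c₂ : ℝ, 0 < c₁ ∧ 0 < c₂ ∧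
      ∀ (𝕜 : Type*) [RCLike 𝕜] (X : Type*) [AddCommGroup X] [Module 𝕜 X]
        (Y : Type*) [AddCommGroup Y] [Module 𝕜 Y] (NX : X → ℝ) (NY : Y → ℝ),
        QuasiEntropy.IsRBanach 𝕜 r NX → QuasiEntropy.IsRBanach 𝕜 r NY →
        ∀ T₀ : X →ₗ[𝕜] Y, QuasiEntropy.IsBoundedOp NX NY T₀ →
        ∀ m n : ℕ, 2 ≤ n → n ≤ m → m ≤ 2 ^ n →
          c₁ * QuasiEntropy.boundA (QuasiEntropy.expo p q) NX NY n m T₀ ≤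
            QuasiEntropy.entropy (QuasiEntropy.lpNorm p m NX) (QuasiEntropy.lpNorm q m NY) n
              (QuasiEntropy.diagOp m T₀) ∧
          QuasiEntropy.entropy (QuasiEntropy.lpNorm p m NX) (QuasiEntropy.lpNorm q m NY) n
              (QuasiEntropy.diagOp m T₀) ≤
            c₂ * QuasiEntropy.boundA (QuasiEntropy.expo p q) NX NY n m T₀ := by
  have hS := QuasiEntropy.sepConst_pos p q r
  refine ⟨(7 ^ QuasiEntropy.expo p q * (16 * QuasiEntropy.sepConst p q r))⁻¹,
    128 ^ (1 / p).toReal, by positivity, by positivity, ?_⟩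
  intro 𝕜 _ X _ _ Y _ _ NX NY hX hY T₀ hT m n hn hnm hm
  constructor
  · rw [inv_mul_le_iff₀ (by positivity)]
    refine (QuasiEntropy.boundA_le hr hX.toIsQuasiNorm hY hT hp hpq hn hnm hm).trans_eq ?_
    ring
  · exact QuasiEntropy.entropy_diagOp_le_boundA hX.toIsQuasiNorm hY.toIsQuasiNorm hT hp hpq hn hnm
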